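/- **Theorem.** Consider the following sixteen orthonormal four-qubit states $|G_1\rangle,\dots,|G_{16}\rangle\in(\mathbb C^2)^{\otimes 4}$, shared by four parties that hold one qubit each (upper and lower signs are taken together): $$\begin{aligned} |G_{1,2}\rangle&=\tfrac12(|0000\rangle\pm|0111\rangle+|1010\rangle\pm|1101\rangle), & |G_{3,4}\rangle&=\tfrac12(|0000\rangle\pm|0111\rangle-|1010\rangle\mp|1101\rangle),\\ |G_{5,6}\rangle&=\tfrac12(|0001\rangle\pm|0110\rangle+|1011\rangle\pm|1100\rangle), & |G_{7,8}\rangle&=\tfrac12(|0001\rangle\pm|0110\rangle-|1011\rangle\mp|1100\rangle),\\ |G_{9,10}\rangle&=\tfrac12(|0010\rangle\pm|0101\rangle+|1000\rangle\pm|1111\rangle), & |G_{11,12}\rangle&=\tfrac12(|0010\rangle\pm|0101\rangle-|1000\rangle\mp|1111\rangle),\\ |G_{13,14}\rangle&=\tfrac12(|0011\rangle\pm|0100\rangle+|1001\rangle\pm|1110\rangle), & |G_{15,16}\rangle&=\tfrac12(|0011\rangle\pm|0100\rangle-|1001\rangle\mp|1110\rangle). \end{aligned}$$ Let the four parties be grouped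 into laboratories, and let $T$ be a known set of $D$ of these states. For a $k$-element subset $\mathcal S'\subset T$ let $$\rho_{\mathcal S'}=\frac1{k!}\sum_{(\phi_1,\dots,\phi_k)}|\phi_1\rangle\langle\phi_1|\otimes\cdots\otimes|\phi_k\rangle\langle\phi_k|,$$ the sum running over all orderings of the elements of $\mathcal S'$; this is the state that the parties share when the elements of $\mathcal S'$ are distributed in an unknown order, each party receiving its qubit of each of the $k$ states. The set $T$ is called locally $(D,k)$-identifiable for the given grouping if there is a protocol of local operations and classical communication (LOCC) between the laboratories, with finitely many rounds and outcomes and with arbitrary joint operations inside each laboratory, which for every $k$-element subset $\mathcal S'\subset T$ outputs $\mathcal S'$ with probability $1$ when it is run on $\rho_{\mathcal S'}$; otherwise $T$ is locally $(D,k)$-unidentifiable for that grouping. Let $2<D\le 16$ and $1<k<D$ be integers with $\binom Dk>2^{3k}$, and let $T$ be any set of $D$ of the sixteen states. Then $T$ is locally $(D,k)$-unidentifiable in every $1:3$ and in every $2:2$ bipartition of the four parties. Consequently, for an arbitrary grouping of the four parties into laboratories, $T$ is locally $(D,k)$-identifiable if and only if all four parties are in the same laboratory. -/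

import Mathlib

open Matrix

/-- A (finite-round) LOCC protocol for labs `L` with final answers in `O`. The lab `l` holds a
quantum system with orthonormal basis indexed by `X l`. Either the protocol stops and all labs
announce a common answer, or there is one more round: every lab `l` performs a quantum measurement
with `m l` outcomes and Kraus operators `K l i` on its own system (possibly changing the dimension
of the system, so ancillas and partial traces are included), all outcomes are broadcast, and the
continuation may depend on all of them. A lab that does nothing in a round uses the one-outcome
measurement with the identity as its Kraus operator. -/
inductive LOCC (L O : Type) : (L → Type) → Type 1
  | answer {X : L → Type} (o : O) : LOCC L O X
  | round {X : L → Type} [∀ l, DecidableEq (X l)]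
      (m : L → ℕ) (d : ∀ l, Fin (m l) → ℕ)
      (K : ∀ l (i : Fin (m l)), Matrix (Fin (d l i)) (X l) ℂ)
      (complete : ∀ l, ∑ i, (K l i)ᴴ * K l i = 1)
      (next : ∀ j : (∀ l, Fin (m l)), LOCC L O (fun l => Fin (d l (j l)))) : LOCC L O X

/-- The tensor product over all labs of the local operators `K l`. -/
def tensorOp {L : Type} [Fintype L] {X Y : L → Type} (K : ∀ l, Matrix (Y l) (X l) ℂ) :
    Matrix (∀ l, Y l) (∀ l, X l) ℂ :=
  Matrix.of fun y x => ∏ l, K l (y l) (x l)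

/-- The probability that the protocol ends with the answer `o` when it is run on the joint state
with density matrix `ρ`. -/
noncomputable def LOCC.prob {L O : Type} [Fintype L] [DecidableEq L] [DecidableEq O] (o : O) :
    {X : L → Type} → [∀ l, Fintype (X l)] → LOCC L O X →
      Matrix (∀ l, X l) (∀ l, X l) ℂ → ℝ
  | _, _, .answer o', ρ => if o' = o then ρ.trace.re else 0
  | _, _, @LOCC.round _ _ _ _ _ _ K _ next, ρ =>
      ∑ j, LOCC.prob o (next j)
        (tensorOp (fun l => K l (j l)) * ρ * (tensorOp (fun l => K l (j l)))ᴴ)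

/-- Basis labels of the system held by the lab `l` when `k` multi-qubit states are distributed
among the parties `P` and the party `p` works in the lab `lab p`: one bit for each of the `k` states
and each party in `l`. -/
abbrev LabSystem {P L : Type} (lab : P → L) (k : ℕ) (l : L) : Type :=
  Fin k → {p : P // lab p = l} → Fin 2

/-- The vector `ψ (a 0) ⊗ ψ (a 1) ⊗ ⋯ ⊗ ψ (a (k - 1))`, with the qubits grouped according to the
labs. -/
def orderedState {P L ι : Type} (ψ : ι → (P → Fin 2) → ℂ) (lab : P → L) {k : ℕ} (a : Fin k → ι) :
    (∀ l, LabSystem lab k l) → ℂ :=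
  fun x => ∏ c, ψ (a c) (fun p => x (lab p) c ⟨p, rfl⟩)

/-- The density matrix shared by the labs when the `k` states with labels in `s` are distributed in
a uniformly random order. -/
noncomputable def subsetState {P L ι : Type} [DecidableEq ι] (ψ : ι → (P → Fin 2) → ℂ)
    (lab : P → L) (k : ℕ) (s : Finset ι) :
    Matrix (∀ l, LabSystem lab k l) (∀ l, LabSystem lab k l) ℂ :=
  ((k.factorial : ℂ))⁻¹ • ∑ e : Fin k ≃ s,
    Matrix.vecMulVec (orderedState ψ lab fun c => (e c : ι))
      (star (orderedState ψ lab fun c => (e c : ι)))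

/-- The states `ψ i`, `i ∈ T`, are locally `(|T|, k)`-identifiable when the parties are grouped in
labs by `lab`: some LOCC protocol between the labs determines, with certainty, every `k`-element
subset of the states from the `k` states themselves, given in an unknown order. -/
def LocallyIdentifiable {P L ι : Type} [Fintype P] [DecidableEq P] [Fintype L]
    [DecidableEq L] [DecidableEq ι]
    (ψ : ι → (P → Fin 2) → ℂ) (lab : P → L) (T : Finset ι) (k : ℕ) : Prop :=
  ∃ π : LOCC L (Finset ι) (LabSystem lab k),
    ∀ s ∈ T.powersetCard k, π.prob s (subsetState ψ lab k s) = 1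

/-- The computational basis vector `|abcd⟩` of four qubits. -/
def ket4 (a b c d : Fin 2) : (Fin 4 → Fin 2) → ℂ := Pi.single ![a, b, c, d] 1

/-- The sixteen four-qubit states. -/
noncomputable def G4 : Fin 16 → (Fin 4 → Fin 2) → ℂ :=
  ![(1 / 2 : ℂ) • (ket4 0 0 0 0 + ket4 0 1 1 1 + ket4 1 0 1 0 + ket4 1 1 0 1),
    (1 / 2 : ℂ) • (ket4 0 0 0 0 - ket4 0 1 1 1 + ket4 1 0 1 0 - ket4 1 1 0 1),
    (1 / 2 : ℂ) • (ket4 0 0 0 0 + ket4 0 1 1 1 - ket4 1 0 1 0 - ket4 1 1 0 1),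
    (1 / 2 : ℂ) • (ket4 0 0 0 0 - ket4 0 1 1 1 - ket4 1 0 1 0 + ket4 1 1 0 1),
    (1 / 2 : ℂ) • (ket4 0 0 0 1 + ket4 0 1 1 0 + ket4 1 0 1 1 + ket4 1 1 0 0),
    (1 / 2 : ℂ) • (ket4 0 0 0 1 - ket4 0 1 1 0 + ket4 1 0 1 1 - ket4 1 1 0 0),
    (1 / 2 : ℂ) • (ket4 0 0 0 1 + ket4 0 1 1 0 - ket4 1 0 1 1 - ket4 1 1 0 0),
    (1 / 2 : ℂ) • (ket4 0 0 0 1 - ket4 0 1 1 0 - ket4 1 0 1 1 + ket4 1 1 0 0),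
    (1 / 2 : ℂ) • (ket4 0 0 1 0 + ket4 0 1 0 1 + ket4 1 0 0 0 + ket4 1 1 1 1),
    (1 / 2 : ℂ) • (ket4 0 0 1 0 - ket4 0 1 0 1 + ket4 1 0 0 0 - ket4 1 1 1 1),
    (1 / 2 : ℂ) • (ket4 0 0 1 0 + ket4 0 1 0 1 - ket4 1 0 0 0 - ket4 1 1 1 1),
    (1 / 2 : ℂ) • (ket4 0 0 1 0 - ket4 0 1 0 1 - ket4 1 0 0 0 + ket4 1 1 1 1),
    (1 / 2 : ℂ) • (ket4 0 0 1 1 + ket4 0 1 0 0 + ket4 1 0 0 1 + ket4 1 1 1 0),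
    (1 / 2 : ℂ) • (ket4 0 0 1 1 - ket4 0 1 0 0 + ket4 1 0 0 1 - ket4 1 1 1 0),
    (1 / 2 : ℂ) • (ket4 0 0 1 1 + ket4 0 1 0 0 - ket4 1 0 0 1 - ket4 1 1 1 0),
    (1 / 2 : ℂ) • (ket4 0 0 1 1 - ket4 0 1 0 0 - ket4 1 0 0 1 + ket4 1 1 1 0)]

/-! The obstruction is a counting bound. Along each branch of a protocol the joint Kraus operator is
a product over the labs. If every candidate state has weight at most `c` times that of the identity
on all product operators (`ProductBounded`), then each correct-answer probability is at most `c`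
times the same probability on the unnormalised identity. The latter sum to at most the dimension, so
perfect identification allows at most `c * dim` candidates (`LOCC.card_le_of_productBounded`).

For a pure state, `c` can be any bound on its largest squared Schmidt coefficient across a cut of
the labs. Each `G4 i` is already in Schmidt form in the computational basis when the qubits outside
a set `B` of labs determine the whole vector within the support, and `exists_cut` finds such a
nonempty `B` for any two distinct labs. Each qubit is uniformly distributed, so the squared
coefficients are at most 1/2. These bounds multiply over the `k` copies and survive averaging over
orderings, giving `choose D k ≤ (1/2)^k * 16^k = 2^(3k)`.

Conversely, a single lab measures every copy in the orthonormal basis `G4` and reads off the subset.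
-/

open scoped ComplexOrder

/-! ### Product operators and the counting bound for LOCC -/

section Tensor

variable {L : Type} [Fintype L] {X Y Z : L → Type}

lemma tensorOp_mul [DecidableEq L] [∀ l, Fintype (Y l)] (F : ∀ l, Matrix (Z l) (Y l) ℂ)
    (K : ∀ l, Matrix (Y l) (X l) ℂ) :
    tensorOp F * tensorOp K = tensorOp fun l => F l * K l := by
  ext z x
  simp only [tensorOp, Matrix.mul_apply, Matrix.of_apply, ← Finset.prod_mul_distrib]
  rw [Finset.prod_univ_sum, Fintype.piFinset_univ]

lemma tensorOp_one [∀ l, DecidableEq (X l)] [DecidableEq (∀ l, X l)] :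
    tensorOp (fun l => (1 : Matrix (X l) (X l) ℂ)) = 1 := by
  ext x y
  simp only [tensorOp, Matrix.of_apply, Matrix.one_apply, funext_iff]
  by_cases h : ∀ l, x l = y l
  · simp [h]
  · rw [if_neg h]
    obtain ⟨l, hl⟩ := not_forall.mp h
    exact Finset.prod_eq_zero (Finset.mem_univ l) (if_neg hl)

lemma tensorOp_conjTranspose (K : ∀ l, Matrix (Y l) (X l) ℂ) :
    (tensorOp K)ᴴ = tensorOp fun l => (K l)ᴴ := by
  ext x y
  simp [tensorOp, Matrix.conjTranspose_apply]

/-- Local measurements performed side by side form a measurement of the joint system. -/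
lemma sum_tensorOp_conjTranspose_mul [DecidableEq L] [∀ l, DecidableEq (X l)]
    [DecidableEq (∀ l, X l)] {m : L → ℕ} {d : ∀ l, Fin (m l) → ℕ}
    (K : ∀ l (i : Fin (m l)), Matrix (Fin (d l i)) (X l) ℂ)
    (complete : ∀ l, ∑ i, (K l i)ᴴ * K l i = 1) :
    ∑ j : (∀ l, Fin (m l)), (tensorOp fun l => K l (j l))ᴴ * (tensorOp fun l => K l (j l)) = 1 := by
  rw [← tensorOp_one]
  simp only [tensorOp_conjTranspose, tensorOp_mul, ← complete]
  ext x y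
  simp only [Matrix.sum_apply, tensorOp, Matrix.of_apply]
  rw [Finset.prod_univ_sum, Fintype.piFinset_univ]

lemma sum_trace_tensorOp_conj [DecidableEq L] [∀ l, Fintype (X l)] [∀ l, DecidableEq (X l)]
    {m : L → ℕ} {d : ∀ l, Fin (m l) → ℕ}
    (K : ∀ l (i : Fin (m l)), Matrix (Fin (d l i)) (X l) ℂ)
    (complete : ∀ l, ∑ i, (K l i)ᴴ * K l i = 1) (ρ : Matrix (∀ l, X l) (∀ l, X l) ℂ) :
    ∑ j : (∀ l, Fin (m l)),
      ((tensorOp fun l => K l (j l)) * ρ * (tensorOp fun l => K l (j l))ᴴ).trace.re =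
        ρ.trace.re := by
  classical
  rw [← Complex.re_sum]
  congr 1
  calc _ = ∑ j : (∀ l, Fin (m l)),
        (((tensorOp fun l => K l (j l))ᴴ * (tensorOp fun l => K l (j l))) * ρ).trace :=
        Finset.sum_congr rfl fun j _ => by
          rw [Matrix.trace_mul_comm, ← Matrix.mul_assoc]
    _ = _ := by
        rw [← Matrix.trace_sum, ← Finset.sum_mul, sum_tensorOp_conjTranspose_mul K complete,
          one_mul]

/-- On every product operator, the weight of `ρ` is at most `c` times the weight of `σ`. -/
def ProductBounded [DecidableEq L] [∀ l, Fintype (X l)] (c : ℝ) (ρ σ : Matrix (∀ l, X l) (∀ l, X l) ℂ) : Prop :=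
  ∀ (Y : L → Type) [∀ l, Fintype (Y l)] (F : ∀ l, Matrix (Y l) (X l) ℂ),
    (tensorOp F * ρ * (tensorOp F)ᴴ).trace.re ≤ c * (tensorOp F * σ * (tensorOp F)ᴴ).trace.re

/-- Products of product operators are product operators. Quantifying over all `F` and all output
spaces makes the bound pass to the next round. -/
lemma ProductBounded.conj [DecidableEq L] [∀ l, Fintype (X l)] [∀ l, Fintype (Y l)] {c : ℝ}
    {ρ σ : Matrix (∀ l, X l) (∀ l, X l) ℂ} (h : ProductBounded c ρ σ)
    (K : ∀ l, Matrix (Y l) (X l) ℂ) :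
    ProductBounded c (tensorOp K * ρ * (tensorOp K)ᴴ) (tensorOp K * σ * (tensorOp K)ᴴ) := by
  intro Z _ F
  have key : ∀ τ : Matrix (∀ l, X l) (∀ l, X l) ℂ,
      tensorOp F * (tensorOp K * τ * (tensorOp K)ᴴ) * (tensorOp F)ᴴ =
        tensorOp (fun l => F l * K l) * τ * (tensorOp fun l => F l * K l)ᴴ := by
    intro τ
    rw [← tensorOp_mul, Matrix.conjTranspose_mul]
    simp only [Matrix.mul_assoc]
  rw [key, key]
  exact h Z _

lemma LOCC.prob_le_of_productBounded {O : Type} [DecidableEq L] [DecidableEq O] (o : O) {c : ℝ}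
    (π : LOCC L O X) : ∀ [∀ l, Fintype (X l)] (ρ σ : Matrix (∀ l, X l) (∀ l, X l) ℂ),
    ProductBounded c ρ σ → π.prob o ρ ≤ c * π.prob o σ := by
  classical
  induction π with
  | @answer X o' =>
    intro _ ρ σ h
    simp only [LOCC.prob]
    split_ifs
    · simpa [tensorOp_one] using h _ (fun l => (1 : Matrix (X l) (X l) ℂ))
    · simp
  | round m d K complete next ih =>
    intro _ ρ σ h
    simp only [LOCC.prob, Finset.mul_sum]
    exact Finset.sum_le_sum fun j _ => ih j _ _ (h.conj _)

/-- Each leaf announces one answer, so no branch is counted twice; positivity permits dropping the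
leaves whose answer lies outside `S`. -/
lemma LOCC.sum_prob_le {O : Type} [DecidableEq L] [DecidableEq O] (S : Finset O)
    (π : LOCC L O X) : ∀ [∀ l, Fintype (X l)] (ρ : Matrix (∀ l, X l) (∀ l, X l) ℂ),
    ρ.PosSemidef → ∑ o ∈ S, π.prob o ρ ≤ ρ.trace.re := by
  classical
  induction π with
  | answer o' =>
    intro _ ρ h
    simp only [LOCC.prob, Finset.sum_ite_eq]
    split_ifs
    · exact le_rfl
    · exact (Complex.nonneg_iff.mp h.trace_nonneg).1
  | round m d K complete next ih =>
    intro _ ρ h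
    simp only [LOCC.prob]
    rw [Finset.sum_comm, ← sum_trace_tensorOp_conj K complete ρ]
    exact Finset.sum_le_sum fun j _ => ih j _ (h.mul_mul_conjTranspose_same _)

/-- A protocol that identifies each of the states `ρ o` with certainty cannot have more than
`c * dim` answers, if the weight of each state on product operators is at most `c` times that of the
identity. -/
lemma LOCC.card_le_of_productBounded {O : Type} [DecidableEq L] [DecidableEq O] (S : Finset O)
    {c : ℝ} (hc : 0 ≤ c) [∀ l, Fintype (X l)] [∀ l, DecidableEq (X l)] (π : LOCC L O X)
    (ρ : O → Matrix (∀ l, X l) (∀ l, X l) ℂ)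
    (h : ∀ o ∈ S, ProductBounded c (ρ o) 1) (hπ : ∀ o ∈ S, π.prob o (ρ o) = 1) :
    (S.card : ℝ) ≤ c * Fintype.card (∀ l, X l) := by
  calc (S.card : ℝ) = ∑ o ∈ S, π.prob o (ρ o) := by
        rw [Finset.sum_congr rfl hπ]; simp
    _ ≤ ∑ o ∈ S, c * π.prob o 1 :=
        Finset.sum_le_sum fun o ho => π.prob_le_of_productBounded o _ _ (h o ho)
    _ = c * ∑ o ∈ S, π.prob o 1 := by rw [Finset.mul_sum]
    _ ≤ c * (1 : Matrix (∀ l, X l) (∀ l, X l) ℂ).trace.re :=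
        mul_le_mul_of_nonneg_left (π.sum_prob_le S _ Matrix.PosSemidef.one) hc
    _ = _ := by rw [Matrix.trace_one, Complex.natCast_re]

end Tensor

/-! ### Weight of an entangled vector on product operators -/

section ProductBound

variable {L : Type} [Fintype L] [DecidableEq L] {X : L → Type} [∀ l, Fintype (X l)]

lemma ProductBounded.average {ι : Type} [Fintype ι] {c : ℝ} {n : ℕ} (hn : Fintype.card ι = n)
    (hn0 : n ≠ 0) {ρ : ι → Matrix (∀ l, X l) (∀ l, X l) ℂ} {σ : Matrix (∀ l, X l) (∀ l, X l) ℂ}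
    (h : ∀ e, ProductBounded c (ρ e) σ) :
    ProductBounded c ((n : ℂ)⁻¹ • ∑ e, ρ e) σ := by
  intro Y _ F
  have hn' : (0 : ℝ) < n := by positivity
  have h1 : (tensorOp F * ((n : ℂ)⁻¹ • ∑ e, ρ e) * (tensorOp F)ᴴ).trace.re =
      (n : ℝ)⁻¹ * ∑ e, (tensorOp F * ρ e * (tensorOp F)ᴴ).trace.re := by
    rw [Matrix.mul_smul, Matrix.smul_mul, Matrix.trace_smul, Matrix.mul_sum, Matrix.sum_mul,
      Matrix.trace_sum, smul_eq_mul, ← Complex.ofReal_natCast, ← Complex.ofReal_inv,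
      Complex.re_ofReal_mul, Complex.re_sum]
  rw [h1, inv_mul_le_iff₀ hn']
  refine (Finset.sum_le_sum fun e _ => h e Y F).trans_eq ?_
  rw [Finset.sum_const, Finset.card_univ, hn, nsmul_eq_mul]

lemma trace_mul_vecMulVec_mul_re {m n : Type} [Fintype m] [Fintype n] (T : Matrix m n ℂ)
    (v : n → ℂ) :
    (T * vecMulVec v (star v) * Tᴴ).trace.re = ∑ y, ‖∑ x, T y x * v x‖ ^ 2 := by
  have h : T * vecMulVec v (star v) * Tᴴ = vecMulVec (T *ᵥ v) (star (T *ᵥ v)) := by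
    rw [Matrix.mul_vecMulVec, Matrix.vecMulVec_mul, Matrix.star_mulVec]
  rw [h, Matrix.trace_vecMulVec, dotProduct, Complex.re_sum]
  refine Finset.sum_congr rfl fun y _ => ?_
  rw [Pi.star_apply, ← starRingEnd_apply, Complex.mul_conj, Complex.ofReal_re,
    Complex.normSq_eq_norm_sq]
  rfl

lemma trace_mul_one_mul_re {m n : Type} [Fintype m] [Fintype n] [DecidableEq n]
    (T : Matrix m n ℂ) : (T * (1 : Matrix n n ℂ) * Tᴴ).trace.re = ∑ y, ∑ x, ‖T y x‖ ^ 2 := by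
  rw [Matrix.mul_one, Matrix.trace, Complex.re_sum]
  refine Finset.sum_congr rfl fun y _ => ?_
  rw [Matrix.diag_apply, Matrix.mul_apply, Complex.re_sum]
  refine Finset.sum_congr rfl fun x _ => ?_
  rw [Matrix.conjTranspose_apply, ← starRingEnd_apply, Complex.mul_conj, Complex.ofReal_re,
    Complex.normSq_eq_norm_sq]

lemma norm_sq_sum_of_disjoint {A : Type} [Fintype A] (u : A → ℂ)
    (h : ∀ a a', u a ≠ 0 → u a' ≠ 0 → a = a') : ‖∑ a, u a‖ ^ 2 = ∑ a, ‖u a‖ ^ 2 := by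
  by_cases h0 : ∃ a, u a ≠ 0
  · obtain ⟨a, ha⟩ := h0
    have hz : ∀ b, b ≠ a → u b = 0 := fun b hb => by
      by_contra hb'
      exact hb (h b a hb' ha)
    rw [Finset.sum_eq_single a (fun b _ hb => hz b hb) (by simp),
      Finset.sum_eq_single a (fun b _ hb => by simp [hz b hb]) (by simp)]
  · push Not at h0
    simp [h0]

/-- A bipartite vector `M` whose rows have disjoint supports and squared norms at most `c` has
weight at most `c` on normalised product operators. -/
lemma sum_norm_sq_bipartite_le {A B A' B' : Type} [Fintype A] [Fintype B] [Fintype A'] [Fintype B']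
    (f : A' → A → ℂ) (g : B' → B → ℂ) (M : A → B → ℂ) {c : ℝ}
    (hdisj : ∀ a a' b, M a b ≠ 0 → M a' b ≠ 0 → a = a') (hM : ∀ a, ∑ b, ‖M a b‖ ^ 2 ≤ c) :
    ∑ a', ∑ b', ‖∑ a, ∑ b, f a' a * g b' b * M a b‖ ^ 2 ≤
      c * ((∑ a', ∑ a, ‖f a' a‖ ^ 2) * ∑ b', ∑ b, ‖g b' b‖ ^ 2) := by
  have row : ∀ a', ∑ b, ‖∑ a, f a' a * M a b‖ ^ 2 ≤ c * ∑ a, ‖f a' a‖ ^ 2 := by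
    intro a'
    calc ∑ b, ‖∑ a, f a' a * M a b‖ ^ 2 = ∑ b, ∑ a, ‖f a' a‖ ^ 2 * ‖M a b‖ ^ 2 := by
          refine Finset.sum_congr rfl fun b _ => ?_
          -- For fixed `b` at most one `a` contributes, so there are no cross terms.
          rw [norm_sq_sum_of_disjoint]
          · simp only [norm_mul, mul_pow]
          · exact fun a₁ a₂ h₁ h₂ => hdisj a₁ a₂ b (right_ne_zero_of_mul h₁)
              (right_ne_zero_of_mul h₂)
      _ = ∑ a, ‖f a' a‖ ^ 2 * ∑ b, ‖M a b‖ ^ 2 := by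
          rw [Finset.sum_comm]
          simp only [Finset.mul_sum]
      _ ≤ ∑ a, ‖f a' a‖ ^ 2 * c := Finset.sum_le_sum fun a _ =>
          mul_le_mul_of_nonneg_left (hM a) (by positivity)
      _ = _ := by rw [← Finset.sum_mul, mul_comm]
  -- Contract the `A` side first, then apply Cauchy–Schwarz over `b`.
  have entry : ∀ a' b', ‖∑ a, ∑ b, f a' a * g b' b * M a b‖ ^ 2 ≤
      (∑ b, ‖g b' b‖ ^ 2) * ∑ b, ‖∑ a, f a' a * M a b‖ ^ 2 := by
    intro a' b'
    have h1 : ∑ a, ∑ b, f a' a * g b' b * M a b = ∑ b, g b' b * ∑ a, f a' a * M a b := by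
      rw [Finset.sum_comm]
      refine Finset.sum_congr rfl fun b _ => ?_
      rw [Finset.mul_sum]
      exact Finset.sum_congr rfl fun a _ => by ring
    calc ‖∑ a, ∑ b, f a' a * g b' b * M a b‖ ^ 2
        ≤ (∑ b, ‖g b' b‖ * ‖∑ a, f a' a * M a b‖) ^ 2 := by
          rw [h1]
          gcongr
          refine (norm_sum_le _ _).trans_eq ?_
          simp only [norm_mul]
      _ ≤ _ := Finset.sum_mul_sq_le_sq_mul_sq _ _ _
  calc ∑ a', ∑ b', ‖∑ a, ∑ b, f a' a * g b' b * M a b‖ ^ 2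
      ≤ ∑ a', ∑ b', (∑ b, ‖g b' b‖ ^ 2) * (c * ∑ a, ‖f a' a‖ ^ 2) := by
        refine Finset.sum_le_sum fun a' _ => Finset.sum_le_sum fun b' _ =>
          (entry a' b').trans ?_
        exact mul_le_mul_of_nonneg_left (row a') (by positivity)
    _ = _ := by
        simp only [← Finset.sum_mul, ← Finset.mul_sum]
        ring

/-- If the labs outside `B` can tell the basis vectors in the support of `v` apart, and every basis
state of the labs in `B` has weight at most `c` in `v`, then `v` has weight at most `c` on
normalised product operators. -/
lemma productBounded_vecMulVec [∀ l, DecidableEq (X l)] (B : L → Prop) [DecidablePred B]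
    (v : (∀ l, X l) → ℂ) {c : ℝ} (hc : 0 ≤ c)
    (hdisj : ∀ x x', v x ≠ 0 → v x' ≠ 0 → (∀ l, ¬ B l → x l = x' l) → x = x')
    (hv : ∀ x : ∀ l, X l, ∑ x' with ∀ l, B l → x' l = x l, ‖v x'‖ ^ 2 ≤ c) :
    ProductBounded c (vecMulVec v (star v)) 1 := by
  intro Y _ F
  rw [trace_mul_vecMulVec_mul_re, trace_mul_one_mul_re]
  let eX := Equiv.piEquivPiSubtypeProd B X
  let eY := Equiv.piEquivPiSubtypeProd B Y
  let f : (∀ l : {l // B l}, Y l) → (∀ l : {l // B l}, X l) → ℂ :=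
    fun y x => ∏ l, F l.1 (y l) (x l)
  let g : (∀ l : {l // ¬ B l}, Y l) → (∀ l : {l // ¬ B l}, X l) → ℂ :=
    fun y x => ∏ l, F l.1 (y l) (x l)
  have hT : ∀ y x, tensorOp F y x = f (eY y).1 (eX x).1 * g (eY y).2 (eX x).2 := fun y x =>
    (Fintype.prod_subtype_mul_prod_subtype B fun l => F l (y l) (x l)).symm
  have hT' : ∀ y x, tensorOp F (eY.symm y) (eX.symm x) = f y.1 x.1 * g y.2 x.2 := fun y x => by
    rw [hT, Equiv.apply_symm_apply, Equiv.apply_symm_apply]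
  have hB : ∀ (q : _ × _) l (hl : B l), eX.symm q l = q.1 ⟨l, hl⟩ := fun q l hl => by
    simp [eX, Equiv.piEquivPiSubtypeProd, hl]
  have hB' : ∀ (q : _ × _) l (hl : ¬ B l), eX.symm q l = q.2 ⟨l, hl⟩ := fun q l hl => by
    simp [eX, Equiv.piEquivPiSubtypeProd, hl]
  have key := sum_norm_sq_bipartite_le f g (fun a b => v (eX.symm (a, b))) (c := c) ?_ ?_
  · convert key using 1
    · rw [← eY.symm.sum_comp, Fintype.sum_prod_type]
      refine Finset.sum_congr rfl fun a' _ => Finset.sum_congr rfl fun b' _ => ?_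
      rw [← eX.symm.sum_comp, Fintype.sum_prod_type]
      simp only [hT']
    · congr 1
      rw [← eY.symm.sum_comp, Fintype.sum_prod_type, Finset.sum_mul_sum]
      refine Finset.sum_congr rfl fun a' _ => Finset.sum_congr rfl fun b' _ => ?_
      rw [← eX.symm.sum_comp, Fintype.sum_prod_type, Finset.sum_mul_sum]
      simp only [hT', norm_mul, mul_pow]
  · intro a a' b h h'
    have := hdisj _ _ h h' fun l hl => by rw [hB' _ l hl, hB' _ l hl]
    exact congrArg Prod.fst (eX.symm.injective this)
  · intro a
    -- A row is indexed by labels in `B` only; any `b₀` completes it to a full label, and the bound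
    -- does not depend on the choice.
    rcases isEmpty_or_nonempty (∀ l : {l // ¬ B l}, X l) with hE | ⟨⟨b₀⟩⟩
    · rw [Finset.univ_eq_empty, Finset.sum_empty]
      exact hc
    · refine le_trans (le_of_eq ?_) (hv (eX.symm (a, b₀)))
      refine Finset.sum_bij (fun b _ => eX.symm (a, b)) ?_ ?_ ?_ ?_
      · intro b _
        simp only [Finset.mem_filter_univ]
        intro l hl
        rw [hB _ l hl, hB _ l hl]
      · intro b _ b' _ h
        exact congrArg Prod.snd (eX.symm.injective h)
      · intro x hx
        simp only [Finset.mem_filter_univ] at hx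
        refine ⟨(eX x).2, Finset.mem_univ _, ?_⟩
        have : (eX x).1 = a := by
          ext ⟨l, hl⟩
          exact (hx l hl).trans (hB (a, b₀) l hl)
        rw [← this]
        exact eX.symm_apply_apply x
      · intro b _
        rfl

end ProductBound

/-! ### Several copies in unknown order -/

section Copies

variable {P L ι : Type}

/-- The basis labels of all labs together, sorted by copies. -/
def copiesEquiv (lab : P → L) (k : ℕ) : (∀ l, LabSystem lab k l) ≃ (Fin k → P → Fin 2) where
  toFun x c p := x (lab p) c ⟨p, rfl⟩
  invFun w l c p := w c p
  left_inv x := by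
    ext l c ⟨p, hp⟩
    subst hp
    rfl
  right_inv w := rfl

lemma orderedState_eq (ψ : ι → (P → Fin 2) → ℂ) (lab : P → L) {k : ℕ} (a : Fin k → ι)
    (x : ∀ l, LabSystem lab k l) :
    orderedState ψ lab a x = ∏ c, ψ (a c) (copiesEquiv lab k x c) := rfl

lemma card_fin_equiv {k : ℕ} {s : Finset ι} [DecidableEq ι] (hs : s.card = k) :
    Fintype.card (Fin k ≃ s) = k.factorial := by
  rw [Fintype.card_equiv (s.equivFinOfCardEq hs).symm, Fintype.card_fin]

variable [Fintype P] [DecidableEq P] [Fintype L] [DecidableEq L]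

lemma card_labSystem (lab : P → L) (k : ℕ) :
    Fintype.card (∀ l, LabSystem lab k l) = 2 ^ (Fintype.card P * k) := by
  rw [Fintype.card_congr (copiesEquiv lab k)]
  simp [pow_mul]

/-- Both hypotheses tensorise: the support is checked copy by copy, and the row weight factors into
one row weight per copy. -/
lemma productBounded_orderedState (ψ : ι → (P → Fin 2) → ℂ) (lab : P → L) (B : L → Prop)
    [DecidablePred B] {c : ℝ} (hc : 0 ≤ c)
    (hdisj : ∀ i x x', ψ i x ≠ 0 → ψ i x' ≠ 0 → (∀ p, ¬ B (lab p) → x p = x' p) → x = x')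
    (hψ : ∀ i (x : P → Fin 2), ∑ x' with ∀ p, B (lab p) → x' p = x p, ‖ψ i x'‖ ^ 2 ≤ c)
    {k : ℕ} (a : Fin k → ι) :
    ProductBounded (c ^ k) (vecMulVec (orderedState ψ lab a) (star (orderedState ψ lab a))) 1 := by
  refine productBounded_vecMulVec B _ (pow_nonneg hc k) ?_ ?_
  · intro x x' hx hx' h
    rw [orderedState_eq, Finset.prod_ne_zero_iff] at hx hx'
    refine (copiesEquiv lab k).injective (funext fun c => ?_)
    refine hdisj _ _ _ (hx c (Finset.mem_univ c)) (hx' c (Finset.mem_univ c)) fun p hp => ?_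
    exact congrFun (congrFun (h _ hp) c) _
  · intro x
    have h1 : ∑ x' with ∀ l, B l → x' l = x l, ‖orderedState ψ lab a x'‖ ^ 2 =
        ∑ w ∈ Fintype.piFinset fun c => ({w | ∀ p, B (lab p) → w p = copiesEquiv lab k x c p} :
          Finset (P → Fin 2)), ∏ c, ‖ψ (a c) (w c)‖ ^ 2 := by
      refine Finset.sum_equiv (copiesEquiv lab k) ?_ ?_
      · intro x'
        simp only [Finset.mem_filter_univ, Fintype.mem_piFinset]
        constructor
        · intro h c p hp
          exact congrFun (congrFun (h _ hp) c) _
        · intro h l hl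
          ext c ⟨p, hp⟩
          subst hp
          exact congrArg Fin.val (h c p hl)
      · intro x' _
        rw [orderedState_eq, norm_prod, Finset.prod_pow]
    rw [h1, ← Finset.prod_univ_sum _ fun c w => ‖ψ (a c) w‖ ^ 2]
    refine (Finset.prod_le_prod (fun c _ => by positivity) fun c _ => hψ (a c) _).trans_eq ?_
    simp

lemma productBounded_subsetState [DecidableEq ι] (ψ : ι → (P → Fin 2) → ℂ) (lab : P → L)
    (B : L → Prop) [DecidablePred B] {c : ℝ} (hc : 0 ≤ c)
    (hdisj : ∀ i x x', ψ i x ≠ 0 → ψ i x' ≠ 0 → (∀ p, ¬ B (lab p) → x p = x' p) → x = x')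
    (hψ : ∀ i (x : P → Fin 2), ∑ x' with ∀ p, B (lab p) → x' p = x p, ‖ψ i x'‖ ^ 2 ≤ c)
    {k : ℕ} {s : Finset ι} (hs : s.card = k) :
    ProductBounded (c ^ k) (subsetState ψ lab k s) 1 :=
  ProductBounded.average (card_fin_equiv hs) k.factorial_ne_zero fun _ =>
    productBounded_orderedState ψ lab B hc hdisj hψ _

/-- A counting bound for local identification of subsets. -/
lemma LocallyIdentifiable.choose_le [DecidableEq ι] {ψ : ι → (P → Fin 2) → ℂ} {lab : P → L}
    {T : Finset ι} {k : ℕ} (h : LocallyIdentifiable ψ lab T k) (B : L → Prop) [DecidablePred B]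
    {c : ℝ} (hc : 0 ≤ c)
    (hdisj : ∀ i x x', ψ i x ≠ 0 → ψ i x' ≠ 0 → (∀ p, ¬ B (lab p) → x p = x' p) → x = x')
    (hψ : ∀ i (x : P → Fin 2), ∑ x' with ∀ p, B (lab p) → x' p = x p, ‖ψ i x'‖ ^ 2 ≤ c) :
    (T.card.choose k : ℝ) ≤ c ^ k * 2 ^ (Fintype.card P * k) := by
  obtain ⟨π, hπ⟩ := h
  have := π.card_le_of_productBounded (T.powersetCard k) (pow_nonneg hc k)
    (subsetState ψ lab k) (fun s hs => productBounded_subsetState ψ lab B hc hdisj hψ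
      (Finset.mem_powersetCard.mp hs).2) hπ
  rw [card_labSystem, Finset.card_powersetCard] at this
  exact_mod_cast this

end Copies

/-! ### Identification inside one laboratory -/

section SingleLab

variable {P L ι : Type} [Fintype P] [DecidableEq P] [Fintype L] [DecidableEq L]

lemma sum_star_orderedState_mul [DecidableEq ι] {ψ : ι → (P → Fin 2) → ℂ}
    (orth : ∀ i j, ∑ x, star (ψ i x) * ψ j x = if i = j then 1 else 0) (lab : P → L) {k : ℕ}
    (a b : Fin k → ι) :
    ∑ x, star (orderedState ψ lab a x) * orderedState ψ lab b x = if a = b then 1 else 0 := by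
  simp only [orderedState_eq, star_prod, ← Finset.prod_mul_distrib]
  rw [(copiesEquiv lab k).sum_comp fun w => ∏ c, star (ψ (a c) (w c)) * ψ (b c) (w c),
    ← Fintype.piFinset_univ, ← Finset.prod_univ_sum _ fun c w => star (ψ (a c) w) * ψ (b c) w]
  simp only [orth]
  rw [Finset.prod_ite_zero]
  simp [funext_iff]

lemma trace_subsetState [DecidableEq ι] {ψ : ι → (P → Fin 2) → ℂ}
    (orth : ∀ i j, ∑ x, star (ψ i x) * ψ j x = if i = j then 1 else 0) (lab : P → L) {k : ℕ}
    {s : Finset ι} (hs : s.card = k) : (subsetState ψ lab k s).trace = 1 := by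
  have h : ∀ a : Fin k → ι,
      (vecMulVec (orderedState ψ lab a) (star (orderedState ψ lab a))).trace = 1 := fun a => by
    rw [Matrix.trace_vecMulVec, dotProduct_comm, dotProduct]
    simpa using sum_star_orderedState_mul orth lab a a
  rw [subsetState, Matrix.trace_smul, Matrix.trace_sum]
  simp only [h]
  rw [Finset.sum_const, Finset.card_univ, card_fin_equiv hs, nsmul_eq_mul, mul_one, smul_eq_mul]
  exact inv_mul_cancel₀ (Nat.cast_ne_zero.mpr k.factorial_ne_zero)

lemma mul_subsetState_eq_zero [DecidableEq ι] {ψ : ι → (P → Fin 2) → ℂ} {lab : P → L} {k : ℕ}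
    {s : Finset ι} {Y : Type} (M : Matrix Y (∀ l, LabSystem lab k l) ℂ)
    (h : ∀ e : Fin k ≃ s, M *ᵥ orderedState ψ lab (fun c => (e c : ι)) = 0) :
    M * subsetState ψ lab k s = 0 := by
  rw [subsetState, Matrix.mul_smul, Matrix.mul_sum]
  simp [Matrix.mul_vecMulVec, h]

/-- Kraus operators of the protocol in which the lab `l₀`, that holds all qubits, measures each copy
in the basis `ψ`, while the other labs, with trivial systems, always obtain the outcome `a₀`. -/
def singleLabKraus (ψ : ι → (P → Fin 2) → ℂ) {lab : P → L} {l₀ : L} (hlab : ∀ p, lab p = l₀)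
    {k : ℕ} [DecidableEq ι] (a₀ : Fin k → ι) (l : L) (a : Fin k → ι) :
    Matrix (Fin 1) (LabSystem lab k l) ℂ :=
  Matrix.of fun _ x =>
    if h : l = l₀ then ∏ c, star (ψ (a c) fun p => x c ⟨p, (hlab p).trans h.symm⟩)
    else if a = a₀ then 1 else 0

lemma singleLabKraus_complete [Fintype ι] [DecidableEq ι] {ψ : ι → (P → Fin 2) → ℂ}
    (compl : ∀ x y, ∑ i, ψ i x * star (ψ i y) = if x = y then 1 else 0) {lab : P → L} {l₀ : L}
    (hlab : ∀ p, lab p = l₀) {k : ℕ} (a₀ : Fin k → ι) (l : L) :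
    ∑ a, (singleLabKraus ψ hlab a₀ l a)ᴴ * singleLabKraus ψ hlab a₀ l a = 1 := by
  ext x y
  simp only [Matrix.sum_apply, Matrix.mul_apply, Fin.sum_univ_one, Matrix.conjTranspose_apply]
  by_cases h : l = l₀
  · subst h
    simp only [singleLabKraus, Matrix.of_apply, dif_pos, star_prod, star_star,
      ← Finset.prod_mul_distrib]
    rw [← Fintype.piFinset_univ, ← Finset.prod_univ_sum _ fun c i =>
      ψ i (fun p => x c ⟨p, hlab p⟩) * star (ψ i fun p => y c ⟨p, hlab p⟩)]
    simp only [compl]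
    rw [Finset.prod_ite_zero, Matrix.one_apply]
    congr 1
    · simp only [Finset.mem_univ, true_imp_iff, funext_iff, Subtype.forall, eq_iff_iff]
      exact forall_congr' fun c => ⟨fun H p _ => H p, fun H p => H p (hlab p)⟩
    · simp
  -- A lab without parties has a one-dimensional system, where the outcome `a₀` alone gives the
  -- identity.
  · have : IsEmpty {p : P // lab p = l} := ⟨fun p => h (p.2.symm.trans (hlab p))⟩
    obtain rfl : x = y := Subsingleton.elim _ _
    rw [Matrix.one_apply_eq]
    simp [singleLabKraus, h]

/-- The joint Kraus operator is a multiple of the bra of the ordered state `a l₀`, which is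
orthogonal to every other ordered state. -/
lemma tensorOp_singleLabKraus_mulVec [DecidableEq ι] {ψ : ι → (P → Fin 2) → ℂ}
    (orth : ∀ i j, ∑ x, star (ψ i x) * ψ j x = if i = j then 1 else 0) {lab : P → L} {l₀ : L}
    (hlab : ∀ p, lab p = l₀) {k : ℕ} (a₀ : Fin k → ι) (a : L → Fin k → ι) (b : Fin k → ι)
    (hb : a l₀ ≠ b) :
    (tensorOp fun l => singleLabKraus ψ hlab a₀ l (a l)) *ᵥ orderedState ψ lab b = 0 := by
  have hx : ∀ (x : ∀ l, LabSystem lab k l) c p l (h : lab p = l),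
      x l c ⟨p, h⟩ = x (lab p) c ⟨p, rfl⟩ := by
    rintro x c p _ rfl
    rfl
  have hT : ∀ y x, tensorOp (fun l => singleLabKraus ψ hlab a₀ l (a l)) y x =
      (∏ l ∈ Finset.univ.erase l₀, if a l = a₀ then 1 else 0) *
        star (orderedState ψ lab (a l₀) x) := by
    intro y x
    rw [tensorOp, Matrix.of_apply, ← Finset.prod_erase_mul _ _ (Finset.mem_univ l₀)]
    congr 1
    · refine Finset.prod_congr rfl fun l hl => ?_
      simp [singleLabKraus, Finset.ne_of_mem_erase hl]
    · simp only [singleLabKraus, Matrix.of_apply, dif_pos, orderedState, star_prod, hx]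
  ext y
  simp only [Matrix.mulVec, dotProduct, hT, mul_assoc, ← Finset.mul_sum,
    sum_star_orderedState_mul orth, if_neg hb, mul_zero, Pi.zero_apply]

/-- A lab that holds all qubits identifies subsets of an orthonormal basis by measuring each copy in
that basis. -/
lemma locallyIdentifiable_of_single_lab [Fintype ι] [DecidableEq ι] [Nonempty ι]
    {ψ : ι → (P → Fin 2) → ℂ}
    (orth : ∀ i j, ∑ x, star (ψ i x) * ψ j x = if i = j then 1 else 0)
    (compl : ∀ x y, ∑ i, ψ i x * star (ψ i y) = if x = y then 1 else 0) {lab : P → L} {l₀ : L}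
    (hlab : ∀ p, lab p = l₀) (T : Finset ι) (k : ℕ) : LocallyIdentifiable ψ lab T k := by
  let a₀ : Fin k → ι := fun _ => Classical.arbitrary ι
  let en : Fin (Fintype.card (Fin k → ι)) ≃ (Fin k → ι) := (Fintype.equivFin _).symm
  have complete : ∀ l, ∑ i, (singleLabKraus ψ hlab a₀ l (en i))ᴴ *
      singleLabKraus ψ hlab a₀ l (en i) = 1 := fun l => by
    rw [en.sum_comp fun a => (singleLabKraus ψ hlab a₀ l a)ᴴ * singleLabKraus ψ hlab a₀ l a]
    exact singleLabKraus_complete compl hlab a₀ l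
  refine ⟨.round (fun _ => Fintype.card (Fin k → ι)) (fun _ _ => 1)
    (fun l i => singleLabKraus ψ hlab a₀ l (en i)) complete
    fun j => .answer (Finset.univ.image (en (j l₀))), fun s hs => ?_⟩
  have hs' := (Finset.mem_powersetCard.mp hs).2
  simp only [LOCC.prob]
  -- Write 1 as the total outcome probability; it then suffices that each outcome with a wrong
  -- answer has probability zero.
  rw [← Complex.one_re, ← trace_subsetState orth lab hs',
    ← sum_trace_tensorOp_conj (fun l i => singleLabKraus ψ hlab a₀ l (en i)) complete]
  refine Finset.sum_congr rfl fun j _ => ?_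
  split_ifs with h
  · rfl
  · rw [mul_subsetState_eq_zero]
    · simp
    · intro e
      refine tensorOp_singleLabKraus_mulVec orth hlab a₀ (fun l => en (j l)) _ fun he => h ?_
      rw [he]
      ext i
      simp only [Finset.mem_image, Finset.mem_univ, true_and]
      exact ⟨fun ⟨c, hc⟩ => hc ▸ (e c).2, fun hi => ⟨e.symm ⟨i, hi⟩, by simp⟩⟩

end SingleLab

/-! ### The sixteen states and their cuts -/

/-- The integer vector that is twice the state `G4 i`. -/
def twiceG4 (i : Fin 16) (x : Fin 4 → Fin 2) : ℤ :=
  if (x 2).val = ((x 0).val + (x 1).val + i.val / 8) % 2 ∧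
      (x 3).val = ((x 1).val + i.val / 4) % 2 then
    (-1) ^ ((x 1).val * i.val + (x 0).val * (i.val / 2)) else 0

lemma ket4_apply (a b c d : Fin 2) (x : Fin 4 → Fin 2) :
    ket4 a b c d x = ((if x = ![a, b, c, d] then 1 else 0 : ℤ) : ℂ) := by
  simp [ket4, Pi.single_apply]

/-- The two high bits of `i` select the support, a coset of the span of 1010 and 0111; the two low
bits select the signs. Integer values turn the later facts about `G4` into finite checks. -/
lemma G4_eq (i : Fin 16) (x : Fin 4 → Fin 2) : G4 i x = (1 / 2 : ℂ) * (twiceG4 i x : ℂ) := by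
  fin_cases i <;>
  · simp only [G4, Fin.zero_eta, Fin.mk_one, Fin.reduceFinMk, Matrix.cons_val, Pi.smul_apply,
      Pi.add_apply, Pi.sub_apply, ket4_apply, smul_eq_mul, ← Int.cast_add, ← Int.cast_sub]
    refine congrArg (fun z : ℤ => (1 / 2 : ℂ) * (z : ℂ)) ?_
    revert x
    decide +kernel

lemma sum_twiceG4_mul : ∀ i j : Fin 16,
    ∑ x, twiceG4 i x * twiceG4 j x = if i = j then 4 else 0 := by
  decide +kernel

lemma sum_twiceG4_sq_marginal : ∀ (i : Fin 16) (p : Fin 4) (v : Fin 2),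
    ∑ x with x p = v, twiceG4 i x ^ 2 = 2 := by
  decide +kernel

lemma sum_twiceG4_mul_index : ∀ x y : Fin 4 → Fin 2,
    ∑ i, twiceG4 i x * twiceG4 i y = if x = y then 4 else 0 := by
  decide +kernel

lemma star_G4 (i : Fin 16) (x : Fin 4 → Fin 2) : star (G4 i x) = G4 i x := by
  simp [G4_eq]

lemma G4_orthonormal (i j : Fin 16) :
    ∑ x, star (G4 i x) * G4 j x = if i = j then 1 else 0 := by
  have h : ∀ x, star (G4 i x) * G4 j x = (1 / 4 : ℂ) * ((twiceG4 i x * twiceG4 j x : ℤ) : ℂ) :=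
    fun x => by rw [star_G4, G4_eq, G4_eq]; push_cast; ring
  simp only [h]
  rw [← Finset.mul_sum, ← Int.cast_sum, sum_twiceG4_mul]
  split_ifs <;> norm_num

lemma G4_complete (x y : Fin 4 → Fin 2) :
    ∑ i, G4 i x * star (G4 i y) = if x = y then 1 else 0 := by
  have h : ∀ i, G4 i x * star (G4 i y) = (1 / 4 : ℂ) * ((twiceG4 i x * twiceG4 i y : ℤ) : ℂ) :=
    fun i => by rw [star_G4, G4_eq, G4_eq]; push_cast; ring
  simp only [h]
  rw [← Finset.mul_sum, ← Int.cast_sum, sum_twiceG4_mul_index]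
  split_ifs <;> norm_num

/-- Every qubit of every state `G4 i` is maximally mixed in the computational basis. -/
lemma G4_marginal (i : Fin 16) (p : Fin 4) (v : Fin 2) :
    ∑ x with x p = v, ‖G4 i x‖ ^ 2 = 1 / 2 := by
  have h : ∀ x, ‖G4 i x‖ ^ 2 = (1 / 4 : ℝ) * ((twiceG4 i x ^ 2 : ℤ) : ℝ) := fun x => by
    rw [G4_eq, norm_mul, mul_pow, Complex.norm_intCast, sq_abs]
    push_cast
    norm_num
  simp only [h]
  rw [← Finset.mul_sum, ← Int.cast_sum, sum_twiceG4_sq_marginal]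
  norm_num

/-- Two basis vectors in the support of the same state differ in one of three sets of qubits. -/
lemma twiceG4_support : ∀ (i : Fin 16) (x x' : Fin 4 → Fin 2), twiceG4 i x ≠ 0 ∧
    twiceG4 i x' ≠ 0 → x = x' ∨ (x 0 ≠ x' 0 ∧ x 2 ≠ x' 2) ∨
      (x 1 ≠ x' 1 ∧ x 2 ≠ x' 2 ∧ x 3 ≠ x' 3) ∨ (x 0 ≠ x' 0 ∧ x 1 ≠ x' 1 ∧ x 3 ≠ x' 3) := by
  decide +kernel

/-- The sets {0,2}, {1,2,3}, {0,1,3} meet pairwise. If the lab of `p` contains one of them, its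
complement contains none, so one of the two sides serves as `B`; both hold a party. -/
lemma exists_cut {L : Type} [DecidableEq L] (lab : Fin 4 → L) {p q : Fin 4}
    (h : lab p ≠ lab q) : ∃ (B : L → Prop) (_ : DecidablePred B), (∃ p, B (lab p)) ∧
      ¬ (B (lab 0) ∧ B (lab 2)) ∧ ¬ (B (lab 1) ∧ B (lab 2) ∧ B (lab 3)) ∧
      ¬ (B (lab 0) ∧ B (lab 1) ∧ B (lab 3)) := by
  by_cases hB : ¬ (lab 0 = lab p ∧ lab 2 = lab p) ∧
      ¬ (lab 1 = lab p ∧ lab 2 = lab p ∧ lab 3 = lab p) ∧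
      ¬ (lab 0 = lab p ∧ lab 1 = lab p ∧ lab 3 = lab p)
  · exact ⟨fun l => l = lab p, inferInstance, ⟨p, rfl⟩, hB⟩
  · exact ⟨fun l => ¬ l = lab p, inferInstance, ⟨q, Ne.symm h⟩, by tauto⟩

lemma not_locallyIdentifiable_G4 {L : Type} [Fintype L] [DecidableEq L] {lab : Fin 4 → L}
    {p q : Fin 4} (h : lab p ≠ lab q) {T : Finset (Fin 16)} {k : ℕ}
    (hk : 2 ^ (3 * k) < T.card.choose k) : ¬ LocallyIdentifiable G4 lab T k := by
  intro hT
  obtain ⟨B, _, ⟨r, hr⟩, h1, h2, h3⟩ := exists_cut lab h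
  have hle := hT.choose_le B (c := 1 / 2) (by norm_num) ?_ ?_
  · have e : (1 / 2 : ℝ) ^ k * 2 ^ (Fintype.card (Fin 4) * k) = 2 ^ (3 * k) := by
      rw [Fintype.card_fin, pow_mul, pow_mul, ← mul_pow]
      norm_num
    rw [e] at hle
    exact absurd hk (not_lt.mpr (by exact_mod_cast hle))
  · intro i x x' hx hx' hxx'
    have hne : ∀ y, G4 i y ≠ 0 → twiceG4 i y ≠ 0 := fun y hy h0 => hy (by simp [G4_eq, h0])
    have hB : ∀ p, x p ≠ x' p → B (lab p) := fun p hp => by_contra fun hb => hp (hxx' p hb)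
    rcases twiceG4_support i x x' ⟨hne x hx, hne x' hx'⟩ with
      he | ⟨a, b⟩ | ⟨a, b, c⟩ | ⟨a, b, c⟩
    · exact he
    · exact (h1 ⟨hB _ a, hB _ b⟩).elim
    · exact (h2 ⟨hB _ a, hB _ b, hB _ c⟩).elim
    · exact (h3 ⟨hB _ a, hB _ b, hB _ c⟩).elim
  · intro i x
    -- Fixing all qubits in `B` is at least as restrictive as fixing the single qubit `r`, whose
    -- marginal weight is 1/2.
    rw [← G4_marginal i r (x r)]
    refine Finset.sum_le_sum_of_subset_of_nonneg ?_ fun _ _ _ => by positivity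
    intro x' hx'
    simp only [Finset.mem_filter_univ] at hx' ⊢
    exact hx' r hr

theorem mainTheorem5 (D k : ℕ) (hD : 2 < D) (hD' : D ≤ 16) (hk : 1 < k) (hk' : k < D)
    (hDk : 2 ^ (3 * k) < D.choose k) (T : Finset (Fin 16)) (hT : T.card = D) :
    (∀ A : Finset (Fin 4), A.card = 1 ∨ A.card = 2 →
      ¬ LocallyIdentifiable G4 (fun p => decide (p ∈ A)) T k) ∧
    (∀ (L : Type) [Fintype L] [DecidableEq L] (lab : Fin 4 → L),
      LocallyIdentifiable G4 lab T k ↔ ∀ p q, lab p = lab q) := by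
  subst hT
  refine ⟨fun A hA => ?_, fun L _ _ lab => ⟨fun h p q => ?_, fun h => ?_⟩⟩
  · obtain ⟨p, hp⟩ : A.Nonempty := Finset.card_pos.mp (by omega)
    obtain ⟨q, hq⟩ : ∃ q, q ∉ A := by
      by_contra! hall
      have := Finset.card_univ (α := Fin 4)
      rw [← Finset.eq_univ_iff_forall.mpr hall, Fintype.card_fin] at this
      omega
    exact not_locallyIdentifiable_G4 (p := p) (q := q) (by simp [hp, hq]) hDk
  · by_contra hpq
    exact not_locallyIdentifiable_G4 hpq hDk h
  · exact locallyIdentifiable_of_single_lab G4_orthonormal G4_complete (fun p => h p 0) T k
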